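/- **Theorem 5.6.** Let $(\Omega,\mu)$ be a $\sigma$-finite measure space with non-atomic measure $\mu$. Functions on $\Omega$ are (real- or complex-valued) measurable functions modulo equality a.e.; $f^*(t)=\inf\{\lambda\ge 0:\mu\{|f|>\lambda\}\le t\}$ is the non-increasing rearrangement of $f$, and $\|\cdot\|_{q,(\alpha,\beta)}$ is the (quasi-)norm of the Lebesgue space $L_q(\alpha,\beta)$. Throughout $1/\infty=0$ and $1/0=\infty$. A Lebesgue measurable $b:(0,\infty)\to(0,\infty)$ is *slowly varying* ($b\in SV$) if for every $\varepsilon>0$ the function $t^{\varepsilon}b(t)$ is equivalent, up to constant factors, to a non-decreasing function and $t^{-\varepsilon}b(t)$ to a non-increasing one. Let $0<\theta\le1$, $0<\varkappa<\infty$, $p=\frac{\varkappa}{1-\theta}$ (so $p=\infty$ if $\theta=1$), $0<q,r,s\le\infty$, and $a,b,c\in SV$ with $$\big\|u^{-1/r}b(u)\big\|_{r,(1,\infty)}<\infty .$$ Put $\tilde a(t)=a(t^{1/\varkappa})$, and similarly $\tilde b,\tilde c$. For a couple $(A_0,A_1)$ of quasi-normed spaces of measurable functions on $\Omega$ let $K(t,f)=\inf\{\|f_0\|_{A_0}+t\|f_1\|_{A_1}: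 f=f_0+f_1,\ f_i\in A_i\}$, and let $(A_0,A_1)^{\mathcal L,\mathcal R}_{\theta,s,c,r,b,q,a}$ be the space of all $f\in A_0+A_1$ for which $$\bigg\|t^{-\frac1s}c(t)\Big\|u^{-\frac1r}b(u)\big\|v^{-\theta-\frac1q}a(v)K(v,f)\big\|_{q,(t,u)}\Big\|_{r,(t,\infty)}\bigg\|_{s,(0,\infty)}<\infty ,$$ quasi-normed by this expression. Let $L^{\mathcal L,\mathcal R}_{p,(s,\tilde c,r,\tilde b,q,\tilde a)}$ be the space of all measurable $f$ for which $$\bigg\|t^{-\frac1s}\tilde c(t)\Big\|u^{-\frac1r}\tilde b(u)\big\|v^{\frac1p-\frac1q}\tilde a(v)f^*(v)\big\|_{q,(t,u)}\Big\|_{r,(t,\infty)}\bigg\|_{s,(0,\infty)}<\infty ,$$ quasi-normed by this expression. Let $L_\varkappa$ and $L_\infty$ be the Lebesgue spaces on $\Omega$, and let $L_{\varkappa,\infty}$ be the weak Lebesgue space with quasi-norm $\sup_{t>0}t^{1/\varkappa}f^*(t)$. Then $$(L_\varkappa,L_\infty)^{\mathcal L,\mathcal R}_{\theta,s,c,r,b,q,a}=(L_{\varkappa,\infty},L_\infty)^{\mathcal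 L,\mathcal R}_{\theta,s,c,r,b,q,a}=L^{\mathcal L,\mathcal R}_{p,(s,\tilde c,r,\tilde b,q,\tilde a)},$$ in the sense that these spaces consist of the same functions and their quasi-norms are equivalent. -/

import Mathlib

open MeasureTheory Set
open scoped ENNReal

/-- A measure is non-atomic: every measurable set of positive measure has a measurable
subset of strictly smaller positive measure. -/
def IsNonatomicMeasure {Ω : Type*} [MeasurableSpace Ω] (μ : Measure Ω) : Prop :=
  ∀ A : Set Ω, MeasurableSet A → 0 < μ A →
    ∃ B : Set Ω, B ⊆ A ∧ MeasurableSet B ∧ 0 < μ B ∧ μ B < μ A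

/-- Two functions are equivalent on `(0, ∞)`: each is bounded by a constant times the other. -/
def EquivOnPos (f g : ℝ → ℝ) : Prop :=
  ∃ C : ℝ, 0 < C ∧ ∀ t : ℝ, 0 < t → f t ≤ C * g t ∧ g t ≤ C * f t

/-- Slowly varying functions on `(0, ∞)`. Only the values on `(0, ∞)` matter. -/
structure IsSlowlyVarying (b : ℝ → ℝ) : Prop where
  /-- Lebesgue measurability on `(0, ∞)`. -/
  measurable : AEMeasurable b (volume.restrict (Ioi 0))
  pos : ∀ t : ℝ, 0 < t → 0 < b t
  increasing : ∀ ε : ℝ, 0 < ε →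
    ∃ g : ℝ → ℝ, MonotoneOn g (Ioi 0) ∧ EquivOnPos (fun t => t ^ ε * b t) g
  decreasing : ∀ ε : ℝ, 0 < ε →
    ∃ g : ℝ → ℝ, AntitoneOn g (Ioi 0) ∧ EquivOnPos (fun t => t ^ (-ε) * b t) g

/-- The rescaled function `u ↦ b (u ^ (1 / κ))`. -/
noncomputable def rescale (κ : ℝ) (b : ℝ → ℝ) : ℝ → ℝ := fun u => b (u ^ (1 / κ))

/-- The (quasi-)norm of the Lebesgue space `L_q` on the subset `I` of the line, for
functions with values in `[0, ∞]`. -/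
noncomputable def normOn (q : ℝ≥0∞) (I : Set ℝ) (g : ℝ → ℝ≥0∞) : ℝ≥0∞ :=
  eLpNorm g q (volume.restrict I)

/-- The weight `t ↦ t ^ (α - 1 / q) * b t`, where `1 / ∞ = 0`. -/
noncomputable def weight (α : ℝ) (q : ℝ≥0∞) (b : ℝ → ℝ) (t : ℝ) : ℝ≥0∞ :=
  ENNReal.ofReal (t ^ (α - (1 / q).toReal) * b t)

/-- The iterated quasi-norm
`‖ t^(-1/s) c(t) ‖ u^(-1/r) b(u) ‖ v^(α-1/q) a(v) g(v) ‖_{q,(t,u)} ‖_{r,(t,∞)} ‖_{s,(0,∞)}`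
of a function `g` on `(0, ∞)`. -/
noncomputable def iteratedNormLR (α : ℝ) (s : ℝ≥0∞) (c : ℝ → ℝ) (r : ℝ≥0∞) (b : ℝ → ℝ)
    (q : ℝ≥0∞) (a : ℝ → ℝ) (g : ℝ → ℝ≥0∞) : ℝ≥0∞ :=
  normOn s (Ioi 0) fun t => weight 0 s c t *
    normOn r (Ioi t) fun u => weight 0 r b u *
      normOn q (Ioo t u) fun v => weight α q a v * g v

/-- The non-increasing rearrangement
`f^*(t) = inf {l ≥ 0 : μ {|f| > l} ≤ t}` (with `inf ∅ = ∞`). -/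
noncomputable def rearrangement {Ω 𝕜 : Type*} [MeasurableSpace Ω] [RCLike 𝕜] {μ : Measure Ω}
    (f : Ω →ₘ[μ] 𝕜) (t : ℝ) : ℝ≥0∞ :=
  sInf {l : ℝ≥0∞ | μ {x | l < ‖f x‖ₑ} ≤ ENNReal.ofReal t}

/-- A space of measurable functions (modulo equality almost everywhere), together with its
quasi-norm. The quasi-norm is recorded as a functional on all measurable functions, but only its
values on the space matter. This only packages data; all spaces below are explicit. -/
structure FunctionSpace {Ω : Type*} [MeasurableSpace Ω] (μ : Measure Ω)
    (𝕜 : Type*) [RCLike 𝕜] where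
  carrier : Set (Ω →ₘ[μ] 𝕜)
  qnorm : (Ω →ₘ[μ] 𝕜) → ℝ≥0∞

namespace FunctionSpace

variable {Ω : Type*} [MeasurableSpace Ω] {μ : Measure Ω} {𝕜 : Type*} [RCLike 𝕜]

/-- The space of all measurable functions at which the functional `N` is finite. -/
def ofQNorm (N : (Ω →ₘ[μ] 𝕜) → ℝ≥0∞) : FunctionSpace μ 𝕜 where
  carrier := {f | N f < ∞}
  qnorm := N

/-- Continuous embedding `X ⊂ Y`. -/
def Embeds (X Y : FunctionSpace μ 𝕜) : Prop :=
  X.carrier ⊆ Y.carrier ∧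
    ∃ C : ℝ, 0 < C ∧ ∀ f ∈ X.carrier, Y.qnorm f ≤ ENNReal.ofReal C * X.qnorm f

/-- `X = Y` as function spaces: the same functions and equivalent quasi-norms. -/
def Same (X Y : FunctionSpace μ 𝕜) : Prop := X.Embeds Y ∧ Y.Embeds X

/-- The algebraic sum `X + Y`. -/
def sumSet (X Y : FunctionSpace μ 𝕜) : Set (Ω →ₘ[μ] 𝕜) :=
  {f | ∃ g ∈ X.carrier, ∃ h ∈ Y.carrier, f = g + h}

/-- Peetre's `K`-functional `K(t, f; X, Y)`. -/
noncomputable def kFunctional (X Y : FunctionSpace μ 𝕜) (t : ℝ) (f : Ω →ₘ[μ] 𝕜) : ℝ≥0∞ :=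
  ⨅ (g ∈ X.carrier) (h ∈ Y.carrier) (_ : f = g + h), X.qnorm g + ENNReal.ofReal t * Y.qnorm h

/-- The `𝓛𝓡` extremal interpolation space `(X, Y)^{𝓛,𝓡}_{θ,s,c,r,b,q,a}`. -/
noncomputable def interpolationLR (X Y : FunctionSpace μ 𝕜) (θ : ℝ) (s : ℝ≥0∞) (c : ℝ → ℝ)
    (r : ℝ≥0∞) (b : ℝ → ℝ) (q : ℝ≥0∞) (a : ℝ → ℝ) : FunctionSpace μ 𝕜 where
  carrier := {f | f ∈ sumSet X Y ∧
    iteratedNormLR (-θ) s c r b q a (fun v => kFunctional X Y v f) < ∞}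
  qnorm := fun f => iteratedNormLR (-θ) s c r b q a (fun v => kFunctional X Y v f)

variable (μ 𝕜)

/-- The Lebesgue space `L_p`. -/
noncomputable def lebesgue (p : ℝ≥0∞) : FunctionSpace μ 𝕜 :=
  ofQNorm fun f => eLpNorm f p μ

/-- The weak Lebesgue space `L_{κ,∞}`, with quasi-norm `sup_{t > 0} t^(1/κ) f^*(t)`. -/
noncomputable def weakLebesgue (κ : ℝ) : FunctionSpace μ 𝕜 :=
  ofQNorm fun f => ⨆ (t : ℝ) (_ : 0 < t), ENNReal.ofReal (t ^ (1 / κ)) * rearrangement f t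

/-- The `𝓛𝓡` Lorentz–Karamata space `L^{𝓛,𝓡}_{p,(s,c,r,b,q,a)}`. -/
noncomputable def lorentzKaramataLR (p s : ℝ≥0∞) (c : ℝ → ℝ) (r : ℝ≥0∞) (b : ℝ → ℝ)
    (q : ℝ≥0∞) (a : ℝ → ℝ) : FunctionSpace μ 𝕜 :=
  ofQNorm fun f => iteratedNormLR (1 / p).toReal s c r b q a (rearrangement f)

end FunctionSpace

/-!
Put `G v = v f^*(v ^ κ)`. Then `G v ≤ K(v, f; L_{κ,∞}, L_∞)`, which is dominated by
`K(v, f; L_κ, L_∞)`. Conversely, truncating `f` at the height `f^*(v ^ κ)` gives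
`K(v, f; L_κ, L_∞) ≤ 3 (∑_j G(2^{-j} v)^κ)^{1/κ}`, a dyadic Hardy operator applied to `G`. This
operator is bounded in the iterated quasi-norm `N`: since the exponent `-θ` beats the growth of the
weights, the dilations `G(2^{-j} ·)` decay geometrically in `N`, and they can be summed because
`N((∑_j G_j^ρ)^{1/ρ}) ≤ (∑_j N(G_j)^ρ)^{1/ρ}` for `ρ ≤ min {q, r, s}`. The substitution
`v = w^{1/κ}` turns `N(G)` into the Lorentz–Karamata quasi-norm of `f`.
-/

section LebesgueQuasiNorm

variable {X : Type*} [MeasurableSpace X] {ν : Measure X} {q : ℝ≥0∞}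

theorem eLpNorm_const_mul_ennreal {C : ℝ≥0∞} (hC : C ≠ ∞) (F : X → ℝ≥0∞) :
    eLpNorm (fun x => C * F x) q ν = C * eLpNorm F q ν := by
  rcases eq_or_ne q 0 with rfl | hq
  · simp
  rcases eq_or_ne q ∞ with rfl | hq'
  · simp [eLpNorm_exponent_top, eLpNormEssSup, ENNReal.essSup_const_mul]
  have hq0 : 0 < q.toReal := ENNReal.toReal_pos hq hq'
  simp only [eLpNorm_eq_lintegral_rpow_enorm_toReal hq hq', enorm_eq_self,
    ENNReal.mul_rpow_of_nonneg _ _ hq0.le]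
  rw [lintegral_const_mul' _ _ (by simp [hC, hq0.le]),
    ENNReal.mul_rpow_of_nonneg _ _ (by positivity), ← ENNReal.rpow_mul,
    mul_one_div_cancel hq0.ne', ENNReal.rpow_one]

theorem eLpNorm_iSup_eq {F : ℕ → X → ℝ≥0∞} (hF : ∀ n, AEMeasurable (F n) ν) (hmono : Monotone F) :
    eLpNorm (fun x => ⨆ n, F n x) q ν = ⨆ n, eLpNorm (F n) q ν := by
  rcases eq_or_ne q 0 with rfl | hq
  · simp
  rcases eq_or_ne q ∞ with rfl | hq'
  · simp only [eLpNorm_exponent_top, eLpNormEssSup, enorm_eq_self]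
    refine le_antisymm (essSup_le_of_ae_le _ ?_)
      (iSup_le fun n => essSup_mono_ae (ae_of_all _ fun x => le_iSup (F · x) n))
    filter_upwards [ae_all_iff.2 fun n => ENNReal.ae_le_essSup (μ := ν) (F n)] with x hx
    exact iSup_mono hx
  have hq0 : 0 < q.toReal := ENNReal.toReal_pos hq hq'
  have hpow {p : ℝ} (hp : 0 < p) (y : ℕ → ℝ≥0∞) : (⨆ n, y n) ^ p = ⨆ n, y n ^ p :=
    (ENNReal.orderIsoRpow p hp).map_iSup y
  simp only [eLpNorm_eq_lintegral_rpow_enorm_toReal hq hq', enorm_eq_self, hpow hq0]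
  rw [lintegral_iSup' (fun n => (hF n).pow_const _)
    (ae_of_all _ fun x _ _ h => ENNReal.rpow_le_rpow (hmono h x) hq0.le), hpow (by positivity)]

theorem eLpNorm_tsum_le (hq : 1 ≤ q) {F : ℕ → X → ℝ≥0∞} (hF : ∀ j, AEMeasurable (F j) ν) :
    eLpNorm (fun x => ∑' j, F j x) q ν ≤ ∑' j, eLpNorm (F j) q ν := by
  simp only [ENNReal.tsum_eq_iSup_nat (f := fun j => F j _)]
  rw [eLpNorm_iSup_eq (F := fun n x => ∑ j ∈ Finset.range n, F j x)
    (fun n => Finset.aemeasurable_fun_sum _ fun j _ => hF j)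
    fun m n hmn x => Finset.sum_le_sum_of_subset (Finset.range_mono hmn)]
  refine iSup_le fun n => le_trans ?_ (ENNReal.sum_le_tsum (Finset.range n))
  simpa only [Finset.sum_fn] using eLpNorm_sum_le (s := Finset.range n)
    (fun j _ => (hF j).aestronglyMeasurable) hq

theorem eLpNorm_rpow_tsum_le {ρ : ℝ} (hρ : 0 < ρ) (hq : ENNReal.ofReal ρ ≤ q)
    {F : ℕ → X → ℝ≥0∞} (hF : ∀ j, AEMeasurable (F j) ν) :
    eLpNorm (fun x => (∑' j, F j x ^ ρ) ^ ρ⁻¹) q ν ≤ (∑' j, eLpNorm (F j) q ν ^ ρ) ^ ρ⁻¹ := by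
  have hρ0 : ENNReal.ofReal ρ ≠ 0 := by simpa using hρ
  have hq1 : 1 ≤ q / ENNReal.ofReal ρ := by
    rwa [ENNReal.le_div_iff_mul_le (Or.inl hρ0) (Or.inl ENNReal.ofReal_ne_top), one_mul]
  have hpow (G : X → ℝ≥0∞) :
      eLpNorm (fun x => G x ^ ρ) (q / ENNReal.ofReal ρ) ν = eLpNorm G q ν ^ ρ := by
    simpa [ENNReal.div_mul_cancel hρ0 ENNReal.ofReal_ne_top] using
      eLpNorm_enorm_rpow (p := q / ENNReal.ofReal ρ) (μ := ν) G hρ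
  have hMinkowski := eLpNorm_tsum_le hq1 fun j => (hF j).pow_const ρ
  rw [ENNReal.le_rpow_inv_iff hρ, ← hpow]
  simpa only [hpow, ENNReal.rpow_inv_rpow hρ.ne'] using hMinkowski

theorem mul_rpow_tsum_rpow_inv {ρ : ℝ} (hρ : 0 < ρ) (w : ℝ≥0∞) (x : ℕ → ℝ≥0∞) :
    w * (∑' j, x j ^ ρ) ^ ρ⁻¹ = (∑' j, (w * x j) ^ ρ) ^ ρ⁻¹ := by
  simp_rw [ENNReal.mul_rpow_of_nonneg _ _ hρ.le, ENNReal.tsum_mul_left]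
  rw [ENNReal.mul_rpow_of_nonneg _ _ (by positivity), ENNReal.rpow_rpow_inv hρ.ne']

theorem tsum_rpow_le_rpow_tsum {p : ℝ} (hp : 1 ≤ p) (x : ℕ → ℝ≥0∞) :
    ∑' j, x j ^ p ≤ (∑' j, x j) ^ p := by
  have hsplit (y : ℝ≥0∞) : y ^ p = y * y ^ (p - 1) := by
    conv_lhs => rw [show p = 1 + (p - 1) by ring,
      ENNReal.rpow_add_of_nonneg _ _ zero_le_one (by linarith), ENNReal.rpow_one]
  calc ∑' j, x j ^ p = ∑' j, x j * x j ^ (p - 1) := by simp_rw [← hsplit]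
    _ ≤ ∑' j, x j * (∑' i, x i) ^ (p - 1) := by
      gcongr with j
      exact ENNReal.le_tsum j
    _ = (∑' j, x j) ^ p := by rw [ENNReal.tsum_mul_right, ← hsplit]

theorem tsum_rpow_rpow_inv_le {ρ κ : ℝ} (hρ : 0 < ρ) (hρκ : ρ ≤ κ) (x : ℕ → ℝ≥0∞) :
    (∑' j, x j ^ κ) ^ κ⁻¹ ≤ (∑' j, x j ^ ρ) ^ ρ⁻¹ := by
  have h := tsum_rpow_le_rpow_tsum ((one_le_div hρ).2 hρκ) fun j => x j ^ ρ
  simp only [← ENNReal.rpow_mul, mul_div_cancel₀ _ hρ.ne'] at h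
  rwa [ENNReal.rpow_inv_le_iff (hρ.trans_le hρκ), ← ENNReal.rpow_mul, inv_mul_eq_div]

theorem tsum_geometric_rpow_ne_top {x : ℝ≥0∞} (hx : x < 1) {ρ : ℝ} (hρ : 0 < ρ) :
    ∑' j : ℕ, (x ^ j) ^ ρ ≠ ∞ := by
  have hxρ : x ^ ρ < 1 := ENNReal.rpow_lt_one hx hρ
  simp_rw [← ENNReal.rpow_natCast, ← ENNReal.rpow_mul, mul_comm _ ρ, ENNReal.rpow_mul,
    ENNReal.rpow_natCast, ENNReal.tsum_geometric]
  simpa [tsub_eq_zero_iff_le] using hxρ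

end LebesgueQuasiNorm

section NormOn

variable {q : ℝ≥0∞} {I : Set ℝ} {F G : ℝ → ℝ≥0∞}

theorem normOn_mono (hI : MeasurableSet I) (h : ∀ x ∈ I, F x ≤ G x) :
    normOn q I F ≤ normOn q I G :=
  eLpNorm_mono_enorm_ae (ae_restrict_of_forall_mem hI (by simpa using h))

theorem normOn_congr (hI : MeasurableSet I) (h : ∀ x ∈ I, F x = G x) :
    normOn q I F = normOn q I G :=
  eLpNorm_congr_ae (ae_restrict_of_forall_mem hI h)

theorem normOn_mono_set {J : Set ℝ} (h : I ⊆ J) : normOn q I F ≤ normOn q J F :=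
  eLpNorm_mono_measure _ (Measure.restrict_mono h le_rfl)

theorem normOn_const_mul {C : ℝ≥0∞} (hC : C ≠ ∞) :
    normOn q I (fun x => C * F x) = C * normOn q I F :=
  eLpNorm_const_mul_ennreal hC F

theorem normOn_eq_top (hI : MeasurableSet I) (hI0 : volume I ≠ 0) (hq : 0 < q)
    (hF : ∀ x ∈ I, F x = ∞) : normOn q I F = ∞ := by
  rw [normOn_congr hI hF, normOn, eLpNorm_const _ hq.ne' (by simpa using hI0)]
  simp [ENNReal.top_mul, hI0, ENNReal.rpow_eq_zero_iff]

theorem measurable_normOn_Ioo (t : ℝ) : Measurable fun u => normOn q (Ioo t u) F :=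
  Monotone.measurable fun _ _ h => normOn_mono_set (Ioo_subset_Ioo_right h)

theorem antitone_normOn_Ioi_Ioo (r : ℝ≥0∞) (W : ℝ → ℝ≥0∞) :
    Antitone fun t => normOn r (Ioi t) fun u => W u * normOn q (Ioo t u) F := fun _ _ h =>
  (normOn_mono_set (Ioi_subset_Ioi h)).trans <| normOn_mono measurableSet_Ioi fun _ _ =>
    mul_le_mul_right (normOn_mono_set (Ioo_subset_Ioo_left h)) _

end NormOn

section Substitution

variable {q : ℝ≥0∞} {I : Set ℝ} {φ φ' : ℝ → ℝ}

theorem ae_restrict_image_iff (hI : MeasurableSet I)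
    (hφ : ∀ x ∈ I, HasDerivWithinAt φ (φ' x) I x) (hφ0 : ∀ x ∈ I, φ' x ≠ 0) (hinj : InjOn φ I)
    {P : ℝ → Prop} :
    (∀ᵐ y ∂volume.restrict (φ '' I), P y) ↔ ∀ᵐ x ∂volume.restrict I, P (φ x) := by
  have hdiff : DifferentiableOn ℝ φ I := fun x hx => (hφ x hx).differentiableWithinAt
  have hdens : AEMeasurable (fun x => ENNReal.ofReal |φ' x|) (volume.restrict I) := by
    simpa using aemeasurable_ofReal_abs_det_fderivWithin volume hI fun x hx =>
      (hφ x hx).hasFDerivWithinAt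
  have hac : volume.restrict I ≪
      (volume.restrict I).withDensity fun x => ENNReal.ofReal |φ' x| :=
    withDensity_absolutelyContinuous' hdens (ae_restrict_of_forall_mem hI fun x hx => by
      simpa using hφ0 x hx)
  have hmap : Measure.map φ ((volume.restrict I).withDensity fun x => ENNReal.ofReal |φ' x|) =
      volume.restrict (φ '' I) := by
    simpa using map_withDensity_abs_det_fderiv_eq_addHaar volume hI.nullMeasurableSet
      (fun x hx => (hφ x hx).hasFDerivWithinAt) hinj
  refine ⟨fun h => hac.ae_le (ae_of_ae_map ((hdiff.continuousOn.aemeasurable hI).mono_ac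
    (withDensity_absolutelyContinuous _ _)) (hmap.symm ▸ h)), fun h => ?_⟩
  rw [ae_restrict_iff' hI] at h
  rw [ae_restrict_iff' (hI.image_of_continuousOn_injOn hdiff.continuousOn hinj)]
  refine measure_mono_null ?_ (addHaar_image_eq_zero_of_differentiableOn_of_addHaar_eq_zero volume
    (s := {x | x ∈ I ∧ ¬P (φ x)}) (hdiff.mono fun _ hx => hx.1) (by
      simpa [ae_iff] using h))
  intro y hy
  obtain ⟨⟨x, hx, rfl⟩, hP⟩ := Classical.not_imp.1 hy
  exact ⟨x, ⟨hx, hP⟩, rfl⟩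

theorem essSup_restrict_image (hI : MeasurableSet I)
    (hφ : ∀ x ∈ I, HasDerivWithinAt φ (φ' x) I x) (hφ0 : ∀ x ∈ I, φ' x ≠ 0) (hinj : InjOn φ I)
    (F : ℝ → ℝ≥0∞) :
    essSup F (volume.restrict (φ '' I)) = essSup (fun x => F (φ x)) (volume.restrict I) :=
  have hae {P : ℝ → Prop} := ae_restrict_image_iff (P := P) hI hφ hφ0 hinj
  le_antisymm (essSup_le_of_ae_le _ (hae.2 (ENNReal.ae_le_essSup _)))
    (essSup_le_of_ae_le _ (hae.1 (ENNReal.ae_le_essSup _)))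

theorem normOn_image (hq : 0 < q) (hI : MeasurableSet I)
    (hφ : ∀ x ∈ I, HasDerivWithinAt φ (φ' x) I x) (hφ0 : ∀ x ∈ I, φ' x ≠ 0) (hinj : InjOn φ I)
    (F : ℝ → ℝ≥0∞) :
    normOn q (φ '' I) F =
      normOn q I fun x => ENNReal.ofReal (|φ' x| ^ (1 / q).toReal) * F (φ x) := by
  rcases eq_or_ne q ∞ with rfl | hq'
  · simpa [normOn, eLpNorm_exponent_top, eLpNormEssSup] using
      essSup_restrict_image hI hφ hφ0 hinj F
  have hq0 : 0 < q.toReal := ENNReal.toReal_pos hq.ne' hq'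
  simp only [normOn, eLpNorm_eq_lintegral_rpow_enorm_toReal hq.ne' hq', enorm_eq_self]
  rw [lintegral_image_eq_lintegral_abs_deriv_mul hI hφ hinj]
  congr 1
  refine setLIntegral_congr_fun hI fun x _ => ?_
  rw [ENNReal.mul_rpow_of_nonneg _ _ hq0.le, ENNReal.ofReal_rpow_of_nonneg (by positivity) hq0.le,
    one_div, ENNReal.toReal_inv, Real.rpow_inv_rpow (abs_nonneg _) hq0.ne']

variable {l m : ℝ}

theorem mul_rpow_lt_mul_rpow_iff (hl : 0 < l) (hm : 0 < m) {x y : ℝ} (hx : 0 ≤ x) (hy : 0 ≤ y) :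
    l * x ^ m < l * y ^ m ↔ x < y := by
  rw [mul_lt_mul_iff_right₀ hl, Real.rpow_lt_rpow_iff hx hy hm]

theorem image_mul_rpow_eq (hl : 0 < l) (hm : 0 < m) {J : Set ℝ} (hI : I ⊆ Ioi 0) (hJ : J ⊆ Ioi 0)
    (h : ∀ x, 0 < x → (l * x ^ m ∈ J ↔ x ∈ I)) : (fun x : ℝ => l * x ^ m) '' I = J := by
  refine Subset.antisymm (image_subset_iff.2 fun x hx => (h x (hI hx)).2 hx) fun y hy => ?_
  have hy0 : 0 < y := hJ hy
  have hinv : l * ((y / l) ^ m⁻¹) ^ m = y := by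
    rw [Real.rpow_inv_rpow (by positivity) hm.ne', mul_div_cancel₀ _ hl.ne']
  exact ⟨(y / l) ^ m⁻¹, (h _ (by positivity)).1 (hinv.symm ▸ hy), hinv⟩

theorem image_mul_rpow_Ioi (hl : 0 < l) (hm : 0 < m) {t : ℝ} (ht : 0 ≤ t) :
    (fun x : ℝ => l * x ^ m) '' Ioi t = Ioi (l * t ^ m) :=
  image_mul_rpow_eq hl hm (Ioi_subset_Ioi ht) (Ioi_subset_Ioi (by positivity))
    fun _ hx => mul_rpow_lt_mul_rpow_iff hl hm ht hx.le

theorem image_mul_rpow_Ioo (hl : 0 < l) (hm : 0 < m) {t u : ℝ} (ht : 0 ≤ t) (hu : 0 ≤ u) :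
    (fun x : ℝ => l * x ^ m) '' Ioo t u = Ioo (l * t ^ m) (l * u ^ m) :=
  image_mul_rpow_eq hl hm (fun _ hx => ht.trans_lt hx.1)
    (fun _ hx => (by positivity : 0 ≤ l * t ^ m).trans_lt hx.1) fun _ hx =>
      and_congr (mul_rpow_lt_mul_rpow_iff hl hm ht hx.le) (mul_rpow_lt_mul_rpow_iff hl hm hx.le hu)

theorem normOn_image_mul_rpow (hl : 0 < l) (hm : 0 < m) (hq : 0 < q) (hI : MeasurableSet I)
    (hI0 : I ⊆ Ioi 0) (F : ℝ → ℝ≥0∞) :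
    normOn q ((fun x : ℝ => l * x ^ m) '' I) F = normOn q I fun x =>
      ENNReal.ofReal ((l * (m * x ^ (m - 1))) ^ (1 / q).toReal) * F (l * x ^ m) := by
  have hpos {x : ℝ} (hx : x ∈ I) : 0 < l * (m * x ^ (m - 1)) := by
    have := mem_Ioi.1 (hI0 hx)
    positivity
  rw [normOn_image (φ' := fun x => l * (m * x ^ (m - 1))) hq hI (fun x hx =>
    ((Real.hasDerivAt_rpow_const (Or.inl (hI0 hx).out.ne')).const_mul l).hasDerivWithinAt)
    (fun x hx => (hpos hx).ne') (StrictMonoOn.injOn fun x hx y hy hxy =>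
      (mul_rpow_lt_mul_rpow_iff hl hm (hI0 hx).out.le (hI0 hy).out.le).2 hxy)]
  exact normOn_congr hI fun x hx => by rw [abs_of_pos (hpos hx)]

end Substitution

section Weight

variable {α : ℝ} {q : ℝ≥0∞} {I : Set ℝ} {a a' : ℝ → ℝ} {F F' : ℝ → ℝ≥0∞}

theorem weight_pos {t : ℝ} (ht : 0 < t) (ha : 0 < a t) : 0 < weight α q a t := by
  rw [weight, ENNReal.ofReal_pos]
  positivity

theorem weight_le_ofReal_mul {A t : ℝ} (hA : 0 ≤ A) (ht : 0 ≤ t) (h : a t ≤ A * a' t) :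
    weight α q a t ≤ ENNReal.ofReal A * weight α q a' t := by
  rw [weight, weight, ← ENNReal.ofReal_mul hA, mul_left_comm]
  gcongr

theorem weight_mul_ofReal {v : ℝ} (hv : 0 < v) :
    weight α q a v * ENNReal.ofReal v = weight (1 + α) q a v := by
  rw [weight, weight, ← ENNReal.ofReal_mul' hv.le, mul_right_comm, ← Real.rpow_add_one hv.ne']
  ring_nf

theorem aemeasurable_weight (ha : AEMeasurable a (volume.restrict (Ioi 0))) (hI : I ⊆ Ioi 0) :
    AEMeasurable (weight α q a) (volume.restrict I) :=
  (((measurable_id.pow_const _).aemeasurable.mul ha).ennreal_ofReal).mono_measure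
    (Measure.restrict_mono hI le_rfl)

theorem normOn_weight_le (hI : MeasurableSet I) (hI0 : I ⊆ Ioi 0) {A : ℝ} (hA : 0 ≤ A)
    {B : ℝ≥0∞} (hB : B ≠ ∞) (ha : ∀ t ∈ I, a t ≤ A * a' t) (hF : ∀ t ∈ I, F t ≤ B * F' t) :
    normOn q I (fun t => weight α q a t * F t) ≤
      ENNReal.ofReal A * B * normOn q I fun t => weight α q a' t * F' t := by
  rw [← normOn_const_mul (by finiteness)]
  refine normOn_mono hI fun t ht => ?_
  rw [mul_mul_mul_comm]
  exact mul_le_mul' (weight_le_ofReal_mul hA (hI0 ht).out.le (ha t ht)) (hF t ht)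

theorem normOn_weight_eq_top (hq : 0 < q) (hI : MeasurableSet I) (hI0 : I ⊆ Ioi 0)
    (hvol : volume I ≠ 0) (ha : ∀ t, 0 < t → 0 < a t) (hF : ∀ t ∈ I, F t = ∞) :
    normOn q I (fun t => weight α q a t * F t) = ∞ :=
  normOn_eq_top hI hvol hq fun t ht => by
    rw [hF t ht, ENNReal.mul_top (weight_pos (hI0 ht) (ha t (hI0 ht))).ne']

theorem normOn_weight_rpow_tsum_le {ρ : ℝ} (hρ : 0 < ρ) (hq : ENNReal.ofReal ρ ≤ q)
    (hI : MeasurableSet I) (hI0 : I ⊆ Ioi 0) (ha : AEMeasurable a (volume.restrict (Ioi 0)))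
    {G : ℕ → ℝ → ℝ≥0∞} (hG : ∀ j, Measurable (G j))
    (hF : ∀ t ∈ I, F t ≤ (∑' j, G j t ^ ρ) ^ ρ⁻¹) :
    normOn q I (fun t => weight α q a t * F t) ≤
      (∑' j, normOn q I (fun t => weight α q a t * G j t) ^ ρ) ^ ρ⁻¹ := by
  refine le_trans (normOn_mono hI fun t ht => ?_) (eLpNorm_rpow_tsum_le hρ hq fun j =>
    (aemeasurable_weight ha hI0).mul (hG j).aemeasurable)
  rw [← mul_rpow_tsum_rpow_inv hρ]
  exact mul_le_mul_right (hF t ht) _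

theorem ofReal_rpow_mul_weight {l m : ℝ} (hl : 0 < l) (hm : 0 < m) {x : ℝ} (hx : 0 < x) :
    ENNReal.ofReal ((l * (m * x ^ (m - 1))) ^ (1 / q).toReal) * weight α q a (l * x ^ m) =
      ENNReal.ofReal (l ^ α * m ^ (1 / q).toReal) *
        weight (m * α) q (fun x => a (l * x ^ m)) x := by
  set k := (1 / q).toReal with hk
  have hlk : l ^ α = l ^ k * l ^ (α - k) := by rw [← Real.rpow_add hl]; ring_nf
  have hxk : x ^ (m * α - k) = x ^ ((m - 1) * k) * x ^ (m * (α - k)) := by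
    rw [← Real.rpow_add hx]; ring_nf
  rw [weight, weight, ← hk, ← ENNReal.ofReal_mul (by positivity),
    ← ENNReal.ofReal_mul (by positivity), Real.mul_rpow hl.le (by positivity),
    Real.mul_rpow hm.le (by positivity), Real.mul_rpow hl.le (by positivity),
    ← Real.rpow_mul hx.le, ← Real.rpow_mul hx.le, hlk, hxk]
  ring_nf

theorem normOn_weight_image_mul_rpow {l m : ℝ} (hl : 0 < l) (hm : 0 < m) (hq : 0 < q)
    (hI : MeasurableSet I) (hI0 : I ⊆ Ioi 0) {B : ℝ≥0∞} (hB : B ≠ ∞)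
    (hF : ∀ x ∈ I, F (l * x ^ m) = B * F' x) :
    normOn q ((fun x : ℝ => l * x ^ m) '' I) (fun y => weight α q a y * F y) =
      ENNReal.ofReal (l ^ α * m ^ (1 / q).toReal) * B *
        normOn q I fun x => weight (m * α) q (fun x => a (l * x ^ m)) x * F' x := by
  rw [normOn_image_mul_rpow hl hm hq hI hI0, ← normOn_const_mul (by finiteness)]
  refine normOn_congr hI fun x hx => ?_
  rw [← mul_assoc, ofReal_rpow_mul_weight hl hm (hI0 hx), hF x hx, mul_mul_mul_comm]

end Weight

section IteratedNorm

variable {α : ℝ} {s r q : ℝ≥0∞} {a b c : ℝ → ℝ} {g g' : ℝ → ℝ≥0∞}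

theorem Ioi_subset_Ioi_zero {t : ℝ} (ht : t ∈ Ioi 0) : Ioi t ⊆ Ioi (0 : ℝ) :=
  Ioi_subset_Ioi (le_of_lt ht)

theorem Ioo_subset_Ioi_zero {t : ℝ} (ht : t ∈ Ioi 0) (u : ℝ) : Ioo t u ⊆ Ioi (0 : ℝ) :=
  Ioo_subset_Ioi_self.trans (Ioi_subset_Ioi_zero ht)

theorem iteratedNormLR_le {a' b' c' : ℝ → ℝ} {A B C : ℝ} {D : ℝ≥0∞} (hA : 0 ≤ A) (hB : 0 ≤ B)
    (hC : 0 ≤ C) (hD : D ≠ ∞) (ha : ∀ t, 0 < t → a t ≤ A * a' t)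
    (hb : ∀ t, 0 < t → b t ≤ B * b' t) (hc : ∀ t, 0 < t → c t ≤ C * c' t)
    (hg : ∀ v, 0 < v → g v ≤ D * g' v) :
    iteratedNormLR α s c r b q a g ≤
      ENNReal.ofReal C * (ENNReal.ofReal B * (ENNReal.ofReal A * D)) *
        iteratedNormLR α s c' r b' q a' g' :=
  normOn_weight_le measurableSet_Ioi subset_rfl hC (by finiteness) hc fun _ ht =>
    normOn_weight_le measurableSet_Ioi (Ioi_subset_Ioi_zero ht) hB (by finiteness)
      (fun u hu => hb u (Ioi_subset_Ioi_zero ht hu)) fun _ _ =>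
    normOn_weight_le measurableSet_Ioo (Ioo_subset_Ioi_zero ht _) hA hD
      (fun v hv => ha v (Ioo_subset_Ioi_zero ht _ hv))
      fun v hv => hg v (Ioo_subset_Ioi_zero ht _ hv)

theorem iteratedNormLR_le_mul {D : ℝ≥0∞} (hD : D ≠ ∞) (hg : ∀ v, 0 < v → g v ≤ D * g' v) :
    iteratedNormLR α s c r b q a g ≤ D * iteratedNormLR α s c r b q a g' := by
  simpa using iteratedNormLR_le (α := α) (s := s) (r := r) (q := q) (a := a) (b := b) (c := c)
    zero_le_one zero_le_one zero_le_one hD (by simp) (by simp) (by simp) hg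

theorem iteratedNormLR_mono (hg : ∀ v, 0 < v → g v ≤ g' v) :
    iteratedNormLR α s c r b q a g ≤ iteratedNormLR α s c r b q a g' := by
  simpa using iteratedNormLR_le_mul ENNReal.one_ne_top (by simpa using hg)

theorem iteratedNormLR_congr (hg : ∀ v, 0 < v → g v = g' v) :
    iteratedNormLR α s c r b q a g = iteratedNormLR α s c r b q a g' :=
  le_antisymm (iteratedNormLR_mono fun v hv => (hg v hv).le)
    (iteratedNormLR_mono fun v hv => (hg v hv).ge)

theorem iteratedNormLR_eq_top (hs : 0 < s) (hr : 0 < r) (hq : 0 < q)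
    (ha : ∀ t, 0 < t → 0 < a t) (hb : ∀ t, 0 < t → 0 < b t) (hc : ∀ t, 0 < t → 0 < c t)
    (hg : ∀ v, 0 < v → g v = ∞) : iteratedNormLR α s c r b q a g = ∞ :=
  normOn_weight_eq_top hs measurableSet_Ioi subset_rfl (by simp) hc fun _ ht =>
    normOn_weight_eq_top hr measurableSet_Ioi (Ioi_subset_Ioi_zero ht) (by simp) hb fun _ hu =>
    normOn_weight_eq_top hq measurableSet_Ioo (Ioo_subset_Ioi_zero ht _) (by simpa using hu) ha
      fun v hv => hg v (Ioo_subset_Ioi_zero ht _ hv)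

theorem iteratedNormLR_rpow_tsum_le {ρ : ℝ} (hρ : 0 < ρ) (hs : ENNReal.ofReal ρ ≤ s)
    (hr : ENNReal.ofReal ρ ≤ r) (hq : ENNReal.ofReal ρ ≤ q)
    (ha : AEMeasurable a (volume.restrict (Ioi 0))) (hb : AEMeasurable b (volume.restrict (Ioi 0)))
    (hc : AEMeasurable c (volume.restrict (Ioi 0))) {G : ℕ → ℝ → ℝ≥0∞}
    (hG : ∀ j, Measurable (G j)) :
    iteratedNormLR α s c r b q a (fun v => (∑' j, G j v ^ ρ) ^ ρ⁻¹) ≤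
      (∑' j, iteratedNormLR α s c r b q a (G j) ^ ρ) ^ ρ⁻¹ :=
  normOn_weight_rpow_tsum_le hρ hs measurableSet_Ioi subset_rfl hc
    (fun _ => (antitone_normOn_Ioi_Ioo _ _).measurable) fun _ ht =>
    normOn_weight_rpow_tsum_le hρ hr measurableSet_Ioi (Ioi_subset_Ioi_zero ht) hb
      (fun _ => measurable_normOn_Ioo _) fun _ _ =>
    normOn_weight_rpow_tsum_le hρ hq measurableSet_Ioo (Ioo_subset_Ioi_zero ht _) ha hG
      fun _ _ => le_rfl

theorem iteratedNormLR_comp_mul_rpow {l m : ℝ} (hl : 0 < l) (hm : 0 < m) (hs : 0 < s) (hr : 0 < r)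
    (hq : 0 < q) :
    iteratedNormLR α s c r b q a g =
      ENNReal.ofReal (m ^ (1 / s).toReal) * (ENNReal.ofReal (m ^ (1 / r).toReal) *
        ENNReal.ofReal (l ^ α * m ^ (1 / q).toReal)) *
      iteratedNormLR (m * α) s (fun x => c (l * x ^ m)) r (fun x => b (l * x ^ m))
        q (fun x => a (l * x ^ m)) (fun x => g (l * x ^ m)) := by
  set φ : ℝ → ℝ := fun x => l * x ^ m
  have hinner {t : ℝ} (ht : t ∈ Ioi 0) {u : ℝ} (hu : u ∈ Ioi t) :
      normOn q (Ioo (φ t) (φ u)) (fun v => weight α q a v * g v) =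
        ENNReal.ofReal (l ^ α * m ^ (1 / q).toReal) *
          normOn q (Ioo t u) fun v => weight (m * α) q (fun x => a (φ x)) v * g (φ v) := by
    rw [← image_mul_rpow_Ioo hl hm ht.out.le (Ioi_subset_Ioi_zero ht hu).out.le,
      normOn_weight_image_mul_rpow hl hm hq measurableSet_Ioo (Ioo_subset_Ioi_zero ht u)
        ENNReal.one_ne_top fun _ _ => (one_mul _).symm, mul_one]
  have hmiddle {t : ℝ} (ht : t ∈ Ioi 0) :
      normOn r (Ioi (φ t)) (fun u => weight 0 r b u *
          normOn q (Ioo (φ t) u) fun v => weight α q a v * g v) =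
        ENNReal.ofReal (m ^ (1 / r).toReal) * ENNReal.ofReal (l ^ α * m ^ (1 / q).toReal) *
          normOn r (Ioi t) fun u => weight 0 r (fun x => b (φ x)) u *
            normOn q (Ioo t u) fun v => weight (m * α) q (fun x => a (φ x)) v * g (φ v) := by
    rw [← image_mul_rpow_Ioi hl hm ht.out.le,
      normOn_weight_image_mul_rpow hl hm hr measurableSet_Ioi (Ioi_subset_Ioi_zero ht)
        ENNReal.ofReal_ne_top fun _ hu => hinner ht hu, mul_zero, Real.rpow_zero, one_mul]
  have himage : φ '' Ioi 0 = Ioi 0 := by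
    rw [image_mul_rpow_Ioi hl hm le_rfl, Real.zero_rpow hm.ne', mul_zero]
  rw [iteratedNormLR, iteratedNormLR]
  conv_lhs => rw [← himage]
  rw [normOn_weight_image_mul_rpow hl hm hs measurableSet_Ioi subset_rfl (by finiteness)
    fun _ ht => hmiddle ht, mul_zero, Real.rpow_zero, one_mul]

end IteratedNorm

/-- Weights `w` on `(0, ∞)` of upper type `ε`: `w (l * t) ≤ C * l ^ ε * w t` for `l ≥ 1`, in the
terminology used for Orlicz functions. The exponent may be negative. A slowly varying function is
of upper type `ε` for every `ε > 0`. -/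
structure IsUpperTypeWeight (ε : ℝ) (w : ℝ → ℝ) : Prop where
  aemeasurable : AEMeasurable w (volume.restrict (Ioi 0))
  pos : ∀ t : ℝ, 0 < t → 0 < w t
  dilation_le : ∃ C : ℝ, 0 < C ∧ ∀ l, 1 ≤ l → ∀ t, 0 < t → w (l * t) ≤ C * l ^ ε * w t

theorem IsSlowlyVarying.isUpperTypeWeight {b : ℝ → ℝ} (hb : IsSlowlyVarying b) {ε : ℝ}
    (hε : 0 < ε) : IsUpperTypeWeight ε b where
  aemeasurable := hb.measurable
  pos := hb.pos
  dilation_le := by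
    obtain ⟨g, hg, D, hD, hDg⟩ := hb.decreasing ε hε
    refine ⟨D * D, by positivity, fun l hl t ht => ?_⟩
    have hl0 : 0 < l := zero_lt_one.trans_le hl
    have hlt : 0 < l * t := by positivity
    have hle : (l * t) ^ (-ε) * b (l * t) ≤ D * (D * (t ^ (-ε) * b t)) :=
      calc (l * t) ^ (-ε) * b (l * t) ≤ D * g (l * t) := (hDg _ hlt).1
        _ ≤ D * g t := by gcongr; exact hg ht hlt (le_mul_of_one_le_left ht.le hl)
        _ ≤ D * (D * (t ^ (-ε) * b t)) := by gcongr; exact (hDg t ht).2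
    rw [Real.mul_rpow hl0.le ht.le, Real.rpow_neg hl0.le, Real.rpow_neg ht.le] at hle
    field_simp at hle
    linarith

section DyadicHardy

variable {α εa εb εc : ℝ} {s r q : ℝ≥0∞} {a b c : ℝ → ℝ}

theorem exists_iteratedNormLR_dilation_le (ha : IsUpperTypeWeight εa a)
    (hb : IsUpperTypeWeight εb b) (hc : IsUpperTypeWeight εc c) (hs : 0 < s) (hr : 0 < r)
    (hq : 0 < q) :
    ∃ C : ℝ≥0∞, C ≠ ∞ ∧ ∀ l : ℝ, 1 ≤ l → ∀ g : ℝ → ℝ≥0∞,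
      iteratedNormLR α s c r b q a (fun v => g (l⁻¹ * v)) ≤
        C * ENNReal.ofReal (l ^ (α + εa + εb + εc)) * iteratedNormLR α s c r b q a g := by
  obtain ⟨A, hA, hAa⟩ := ha.dilation_le
  obtain ⟨B, hB, hBb⟩ := hb.dilation_le
  obtain ⟨C, hC, hCc⟩ := hc.dilation_le
  refine ⟨ENNReal.ofReal (A * B * C), ENNReal.ofReal_ne_top, fun l hl g => ?_⟩
  have hl0 : 0 < l := zero_lt_one.trans_le hl
  have hweights := iteratedNormLR_le (α := α) (s := s) (r := r) (q := q) (g := g) (g' := g)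
    (by positivity) (by positivity) (by positivity) ENNReal.one_ne_top (hAa l hl) (hBb l hl)
    (hCc l hl) (by simp)
  rw [iteratedNormLR_comp_mul_rpow hl0 one_pos hs hr hq]
  simp only [Real.rpow_one, Real.one_rpow, one_mul, mul_one, inv_mul_cancel_left₀ hl0.ne',
    ENNReal.ofReal_one] at hweights ⊢
  refine (mul_le_mul_right hweights _).trans (le_of_eq ?_)
  rw [← mul_assoc, ← ENNReal.ofReal_mul (by positivity), ← ENNReal.ofReal_mul (by positivity),
    ← ENNReal.ofReal_mul (by positivity), ← ENNReal.ofReal_mul (by positivity),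
    Real.rpow_add hl0, Real.rpow_add hl0, Real.rpow_add hl0]
  ring_nf

theorem exists_iteratedNormLR_halving_le (hα : α + εa + εb + εc < 0)
    (ha : IsUpperTypeWeight εa a) (hb : IsUpperTypeWeight εb b) (hc : IsUpperTypeWeight εc c)
    (hs : 0 < s) (hr : 0 < r) (hq : 0 < q) :
    ∃ C : ℝ≥0∞, C ≠ ∞ ∧ ∃ x : ℝ≥0∞, x < 1 ∧ ∀ (G : ℝ → ℝ≥0∞) (j : ℕ),
      iteratedNormLR α s c r b q a (fun v => G (2⁻¹ ^ j * v)) ≤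
        C * iteratedNormLR α s c r b q a G * x ^ j := by
  obtain ⟨C, hC, hdilation⟩ := exists_iteratedNormLR_dilation_le (α := α) ha hb hc hs hr hq
  refine ⟨C, hC, ENNReal.ofReal (2 ^ (α + εa + εb + εc)), by
    simpa using Real.rpow_lt_one_of_one_lt_of_neg one_lt_two hα, fun G j => ?_⟩
  have h := hdilation (2 ^ j) (one_le_pow₀ one_le_two) G
  rwa [← inv_pow, ← Real.rpow_pow_comm zero_le_two, ENNReal.ofReal_pow (by positivity),
    mul_right_comm] at h

/-- A dyadic version of the Hardy operator `G ↦ (∫₀^v G(τ)^κ dτ/τ)^(1/κ)`: the `ℓ^κ` quasi-norm of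
the values of `G` at `v, v / 2, v / 4, …`. -/
noncomputable def dyadicHardy (κ : ℝ) (G : ℝ → ℝ≥0∞) (v : ℝ) : ℝ≥0∞ :=
  (∑' j : ℕ, G (2⁻¹ ^ j * v) ^ κ) ^ κ⁻¹

theorem le_dyadicHardy {κ : ℝ} (hκ : 0 < κ) (G : ℝ → ℝ≥0∞) (v : ℝ) : G v ≤ dyadicHardy κ G v := by
  rw [dyadicHardy, ENNReal.le_rpow_inv_iff hκ]
  simpa using ENNReal.le_tsum (f := fun j : ℕ => G (2⁻¹ ^ j * v) ^ κ) 0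

theorem exists_ofReal_le {m : ℝ≥0∞} (hm : 0 < m) : ∃ ρ : ℝ, 0 < ρ ∧ ENNReal.ofReal ρ ≤ m := by
  obtain ⟨ρ, hρ, hρm⟩ := ENNReal.lt_iff_exists_nnreal_btwn.1 hm
  exact ⟨ρ, by simpa using hρ, by simpa using hρm.le⟩

theorem exists_iteratedNormLR_dyadicHardy_le {κ : ℝ} (hκ : 0 < κ) (hα : α + εa + εb + εc < 0)
    (ha : IsUpperTypeWeight εa a) (hb : IsUpperTypeWeight εb b) (hc : IsUpperTypeWeight εc c)
    (hs : 0 < s) (hr : 0 < r) (hq : 0 < q) :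
    ∃ D : ℝ≥0∞, D ≠ ∞ ∧ ∀ G : ℝ → ℝ≥0∞, Measurable G →
      iteratedNormLR α s c r b q a (dyadicHardy κ G) ≤ D * iteratedNormLR α s c r b q a G := by
  obtain ⟨ρ, hρ, hρmin⟩ := exists_ofReal_le (m := min (ENNReal.ofReal κ) (min s (min r q)))
    (by simp [hκ, hs, hr, hq])
  simp only [le_min_iff, ENNReal.ofReal_le_ofReal_iff hκ.le] at hρmin
  obtain ⟨hρκ, hρs, hρr, hρq⟩ := hρmin
  obtain ⟨C, hC, x, hx, hhalving⟩ := exists_iteratedNormLR_halving_le hα ha hb hc hs hr hq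
  refine ⟨C * (∑' j : ℕ, (x ^ j) ^ ρ) ^ ρ⁻¹, ENNReal.mul_ne_top hC
    (ENNReal.rpow_ne_top_of_nonneg (by positivity) (tsum_geometric_rpow_ne_top hx hρ)),
    fun G hG => ?_⟩
  calc iteratedNormLR α s c r b q a (dyadicHardy κ G)
      ≤ iteratedNormLR α s c r b q a (fun v => (∑' j : ℕ, G (2⁻¹ ^ j * v) ^ ρ) ^ ρ⁻¹) :=
        iteratedNormLR_mono fun _ _ => tsum_rpow_rpow_inv_le hρ hρκ _
    _ ≤ (∑' j : ℕ, iteratedNormLR α s c r b q a (fun v => G (2⁻¹ ^ j * v)) ^ ρ) ^ ρ⁻¹ :=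
        iteratedNormLR_rpow_tsum_le (G := fun j v => G (2⁻¹ ^ j * v)) hρ hρs hρr hρq
          ha.aemeasurable hb.aemeasurable hc.aemeasurable
          fun _ => hG.comp (measurable_const_mul _)
    _ ≤ (∑' j : ℕ, (C * iteratedNormLR α s c r b q a G * x ^ j) ^ ρ) ^ ρ⁻¹ := by
        gcongr with j
        exact hhalving G j
    _ = C * (∑' j : ℕ, (x ^ j) ^ ρ) ^ ρ⁻¹ * iteratedNormLR α s c r b q a G := by
        rw [← mul_rpow_tsum_rpow_inv hρ, mul_right_comm]

end DyadicHardy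

section Rearrangement

variable {Ω 𝕜 : Type*} [MeasurableSpace Ω] [RCLike 𝕜] {μ : Measure Ω}

theorem antitone_rearrangement (f : Ω →ₘ[μ] 𝕜) : Antitone (rearrangement f) := fun _ _ h =>
  sInf_le_sInf fun _ hl => hl.trans (ENNReal.ofReal_le_ofReal h)

theorem measure_rearrangement_lt_le (f : Ω →ₘ[μ] 𝕜) (t : ℝ) :
    μ {x | rearrangement f t < ‖f x‖ₑ} ≤ ENNReal.ofReal t := by
  obtain ⟨l, hanti, hlim, hl⟩ := exists_seq_tendsto_sInf
    (S := {l : ℝ≥0∞ | μ {x | l < ‖f x‖ₑ} ≤ ENNReal.ofReal t}) ⟨∞, by simp⟩ (OrderBot.bddBelow _)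
  have hunion : {x | rearrangement f t < ‖f x‖ₑ} ⊆ ⋃ n, {x | l n < ‖f x‖ₑ} := fun x hx =>
    mem_iUnion.2 (hlim.eventually_lt_const (show _ < ‖f x‖ₑ from hx)).exists
  calc μ {x | rearrangement f t < ‖f x‖ₑ} ≤ μ (⋃ n, {x | l n < ‖f x‖ₑ}) := measure_mono hunion
    _ = ⨆ n, μ {x | l n < ‖f x‖ₑ} :=
        Monotone.measure_iUnion fun _ _ h _ hx => (hanti h).trans_lt hx
    _ ≤ ENNReal.ofReal t := iSup_le hl

theorem rearrangement_add_le (g h : Ω →ₘ[μ] 𝕜) (t : ℝ) :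
    rearrangement (g + h) t ≤ rearrangement g t + eLpNorm h ∞ μ := by
  refine sInf_le ((measure_mono_ae ?_).trans (measure_rearrangement_lt_le g t))
  filter_upwards [AEEqFun.coeFn_add g h, ae_le_eLpNormEssSup (f := h) (μ := μ)]
    with x hadd hle (hlt : _ < ‖(g + h) x‖ₑ)
  rw [hadd, eLpNorm_exponent_top] at hlt
  exact lt_of_add_lt_add_right <| hlt.trans_le <|
    (enorm_add_le (g x) (h x)).trans (add_le_add_right hle _)

theorem rpow_mul_rearrangement_le {κ : ℝ} (hκ : 0 < κ) (f : Ω →ₘ[μ] 𝕜) {t : ℝ} (ht : 0 < t) :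
    ENNReal.ofReal (t ^ (1 / κ)) * rearrangement f t ≤ eLpNorm f (ENNReal.ofReal κ) μ := by
  refine ENNReal.mul_le_of_forall_lt fun x hx l hl => (ENNReal.rpow_le_rpow_iff hκ).1 ?_
  have hlt : ¬μ {x | l < ‖f x‖ₑ} ≤ ENNReal.ofReal t := fun h => hl.not_ge (sInf_le h)
  have hmeas : ENNReal.ofReal t ≤ μ {x | l ≤ ‖f x‖ₑ} :=
    (not_le.1 hlt).le.trans (measure_mono fun x (hx : l < ‖f x‖ₑ) => hx.le)
  have hchebyshev := mul_meas_ge_le_pow_eLpNorm' μ (p := ENNReal.ofReal κ) (by simpa using hκ)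
    ENNReal.ofReal_ne_top f.aestronglyMeasurable l
  rw [ENNReal.toReal_ofReal hκ.le] at hchebyshev
  calc (x * l) ^ κ ≤ (ENNReal.ofReal (t ^ (1 / κ)) * l) ^ κ := by gcongr
    _ = l ^ κ * ENNReal.ofReal t := by
        rw [ENNReal.mul_rpow_of_nonneg _ _ hκ.le, ENNReal.ofReal_rpow_of_nonneg (by positivity)
          hκ.le, one_div, Real.rpow_inv_rpow ht.le hκ.ne', mul_comm]
    _ ≤ l ^ κ * μ {x | l ≤ ‖f x‖ₑ} := by gcongr
    _ ≤ eLpNorm f (ENNReal.ofReal κ) μ ^ κ := hchebyshev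

/-- The function `v ↦ v f^*(v ^ κ)`, which describes `K(v, f; L_κ, L_∞)` up to a Hardy operator. -/
noncomputable def scaledRearrangement (κ : ℝ) (f : Ω →ₘ[μ] 𝕜) (v : ℝ) : ℝ≥0∞ :=
  ENNReal.ofReal v * rearrangement f (v ^ κ)

theorem measurable_scaledRearrangement (κ : ℝ) (f : Ω →ₘ[μ] 𝕜) :
    Measurable (scaledRearrangement κ f) :=
  ENNReal.measurable_ofReal.mul
    ((antitone_rearrangement f).measurable.comp (measurable_id.pow_const κ))

theorem setLIntegral_lt_le_tsum {g : Ω → ℝ≥0∞} (hg : Measurable g) {L : ℕ → ℝ≥0∞}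
    (hL : ∀ᵐ x ∂μ, ∃ j, g x ≤ L j) :
    ∫⁻ x in {x | L 0 < g x}, g x ∂μ ≤ ∑' j, L (j + 1) * μ {x | L j < g x} := by
  have hmeas (j : ℕ) : MeasurableSet {x | L j < g x} := measurableSet_lt measurable_const hg
  simp only [← lintegral_indicator_const (hmeas _)]
  rw [← lintegral_indicator (hmeas 0),
    ← lintegral_tsum fun j => (measurable_const.indicator (hmeas j)).aemeasurable]
  refine lintegral_mono_ae ?_
  filter_upwards [hL] with x hx
  by_cases h0 : L 0 < g x
  · -- The first level above `g x` has index `k + 1`, so the `k`-th summand dominates `g x`.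
    classical
    obtain ⟨k, hk⟩ : ∃ k, Nat.find hx = k + 1 :=
      Nat.exists_eq_succ_of_ne_zero fun h => h0.not_ge (h ▸ Nat.find_spec hx)
    have hlt : L k < g x := not_le.1 (Nat.find_min hx (by lia))
    calc {x | L 0 < g x}.indicator g x = g x := indicator_of_mem (by exact h0) g
      _ ≤ L (k + 1) := hk ▸ Nat.find_spec hx
      _ = {x | L k < g x}.indicator (fun _ => L (k + 1)) x := by
          rw [indicator_of_mem (by exact hlt)]
      _ ≤ _ := ENNReal.le_tsum k
  · rw [indicator_of_notMem (by exact h0)]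
    exact zero_le

theorem ae_exists_enorm_le_rearrangement (f : Ω →ₘ[μ] 𝕜) {t : ℕ → ℝ}
    (ht : Filter.Tendsto t Filter.atTop (nhds 0)) :
    ∀ᵐ x ∂μ, ∃ j, ‖f x‖ₑ ≤ rearrangement f (t j) := by
  have hlim : Filter.Tendsto (fun j => ENNReal.ofReal (t j)) Filter.atTop (nhds 0) := by
    simpa using ENNReal.tendsto_ofReal ht
  refine nonpos_iff_eq_zero.1 (ge_of_tendsto' hlim fun j => ?_)
  refine (measure_mono fun x hx => ?_).trans (measure_rearrangement_lt_le f (t j))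
  exact not_le.1 fun hle => hx ⟨j, hle⟩

theorem setLIntegral_rearrangement_lt_le {κ : ℝ} (hκ : 0 < κ) (f : Ω →ₘ[μ] 𝕜) {t : ℕ → ℝ}
    (ht : Filter.Tendsto t Filter.atTop (nhds 0)) :
    ∫⁻ x in {x | rearrangement f (t 0) < ‖f x‖ₑ}, ‖f x‖ₑ ^ κ ∂μ ≤
      ∑' j, rearrangement f (t (j + 1)) ^ κ * ENNReal.ofReal (t j) := by
  have h := setLIntegral_lt_le_tsum (μ := μ) (f.measurable.enorm.pow_const κ)
    (L := fun j => rearrangement f (t j) ^ κ)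
    ((ae_exists_enorm_le_rearrangement f ht).mono fun x hx =>
      hx.imp fun _ hj => ENNReal.rpow_le_rpow hj hκ.le)
  simp only [ENNReal.rpow_lt_rpow_iff hκ] at h
  refine h.trans (ENNReal.tsum_le_tsum fun j => ?_)
  gcongr
  exact measure_rearrangement_lt_le f (t j)

theorem eLpNorm_restrict_rearrangement_lt_le {κ : ℝ} (hκ : 0 < κ) (f : Ω →ₘ[μ] 𝕜) {v : ℝ}
    (hv : 0 < v) :
    eLpNorm f (ENNReal.ofReal κ) (μ.restrict {x | rearrangement f (v ^ κ) < ‖f x‖ₑ}) ≤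
      2 * dyadicHardy κ (scaledRearrangement κ f) v := by
  set w : ℕ → ℝ := fun j => 2⁻¹ ^ j * v with hw
  have hw0 (j : ℕ) : 0 < w j := by positivity
  have hlim : Filter.Tendsto (fun j => w j ^ κ) Filter.atTop (nhds 0) := by
    have := ((tendsto_pow_atTop_nhds_zero_of_lt_one (r := (2⁻¹ : ℝ)) (by norm_num)
      (by norm_num)).mul_const v).rpow_const (p := κ) (Or.inr hκ.le)
    simpa [hw, Real.zero_rpow hκ.ne'] using this
  have hterm (j : ℕ) : rearrangement f (w (j + 1) ^ κ) ^ κ * ENNReal.ofReal (w j ^ κ) =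
      2 ^ κ * scaledRearrangement κ f (w (j + 1)) ^ κ := by
    have hdouble : w j = 2 * w (j + 1) := by simp only [hw]; ring
    rw [scaledRearrangement, ← ENNReal.ofReal_rpow_of_pos (hw0 j), hdouble,
      ENNReal.ofReal_mul zero_le_two, ENNReal.ofReal_ofNat]
    simp only [ENNReal.mul_rpow_of_nonneg _ _ hκ.le]
    ring
  have hintegral := setLIntegral_rearrangement_lt_le hκ f hlim
  simp only [hterm, ENNReal.tsum_mul_left] at hintegral
  rw [eLpNorm_eq_lintegral_rpow_enorm_toReal (by simpa using hκ) ENNReal.ofReal_ne_top,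
    ENNReal.toReal_ofReal hκ.le, one_div, ENNReal.rpow_inv_le_iff hκ,
    ENNReal.mul_rpow_of_nonneg _ _ hκ.le, dyadicHardy, ENNReal.rpow_inv_rpow hκ.ne']
  have hshift : ∑' j, scaledRearrangement κ f (w (j + 1)) ^ κ ≤
      ∑' j, scaledRearrangement κ f (w j) ^ κ :=
    ENNReal.tsum_comp_le_tsum_of_injective (add_left_injective 1)
      fun j => scaledRearrangement κ f (w j) ^ κ
  simpa [hw] using hintegral.trans (mul_le_mul_right hshift _)

end Rearrangement

namespace FunctionSpace

section KFunctional

variable {Ω 𝕜 : Type*} [MeasurableSpace Ω] [RCLike 𝕜] {μ : Measure Ω}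
  {X Y X' Y' : FunctionSpace μ 𝕜}

theorem kFunctional_add_le {g h : Ω →ₘ[μ] 𝕜} (hg : g ∈ X.carrier) (hh : h ∈ Y.carrier) (t : ℝ) :
    kFunctional X Y t (g + h) ≤ X.qnorm g + ENNReal.ofReal t * Y.qnorm h :=
  iInf₂_le_of_le g hg (iInf₂_le_of_le h hh (iInf_le _ rfl))

theorem le_kFunctional {t : ℝ} {f : Ω →ₘ[μ] 𝕜} {x : ℝ≥0∞}
    (h : ∀ g ∈ X.carrier, ∀ k ∈ Y.carrier, f = g + k →
      x ≤ X.qnorm g + ENNReal.ofReal t * Y.qnorm k) : x ≤ kFunctional X Y t f :=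
  le_iInf₂ fun g hg => le_iInf₂ fun k hk => le_iInf (h g hg k hk)

theorem mem_sumSet_of_kFunctional_ne_top {t : ℝ} {f : Ω →ₘ[μ] 𝕜}
    (h : kFunctional X Y t f ≠ ∞) : f ∈ sumSet X Y := by
  contrapose! h
  exact top_le_iff.1 (le_kFunctional fun g hg k hk hgk => absurd ⟨g, hg, k, hk, hgk⟩ h)

theorem kFunctional_lebesgue_le_restrict (p q : ℝ≥0∞) {t : ℝ} (ht : 0 < t) (f : Ω →ₘ[μ] 𝕜)
    {S : Set Ω} (hS : MeasurableSet S) :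
    kFunctional (lebesgue μ 𝕜 p) (lebesgue μ 𝕜 q) t f ≤
      eLpNorm f p (μ.restrict S) + ENNReal.ofReal t * eLpNorm f q (μ.restrict Sᶜ) := by
  by_cases htop : eLpNorm f p (μ.restrict S) + ENNReal.ofReal t * eLpNorm f q (μ.restrict Sᶜ) = ∞
  · exact htop ▸ le_top
  simp only [ENNReal.add_eq_top, ENNReal.mul_eq_top, not_or, not_and] at htop
  set g := AEEqFun.mk (S.indicator f) (f.aestronglyMeasurable.indicator hS)
  set k := AEEqFun.mk (Sᶜ.indicator f) (f.aestronglyMeasurable.indicator hS.compl)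
  have hg : g =ᵐ[μ] S.indicator f := AEEqFun.coeFn_mk _ _
  have hk : k =ᵐ[μ] Sᶜ.indicator f := AEEqFun.coeFn_mk _ _
  have hsplit : f = g + k := by
    refine AEEqFun.ext ?_
    filter_upwards [AEEqFun.coeFn_add g k, hg, hk] with x hadd hgx hkx
    rw [hadd, Pi.add_apply, hgx, hkx, ← Pi.add_apply, indicator_self_add_compl]
  rw [← eLpNorm_indicator_eq_eLpNorm_restrict hS, ← eLpNorm_congr_ae hg,
    ← eLpNorm_indicator_eq_eLpNorm_restrict hS.compl, ← eLpNorm_congr_ae hk] at htop ⊢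
  conv_lhs => rw [hsplit]
  exact kFunctional_add_le (lt_top_iff_ne_top.2 htop.1)
    (lt_top_iff_ne_top.2 (htop.2.1 (by simpa using ht))) t

theorem kFunctional_lebesgue_le_dyadicHardy {κ : ℝ} (hκ : 0 < κ) (f : Ω →ₘ[μ] 𝕜) {v : ℝ}
    (hv : 0 < v) :
    kFunctional (lebesgue μ 𝕜 (ENNReal.ofReal κ)) (lebesgue μ 𝕜 ∞) v f ≤
      3 * dyadicHardy κ (scaledRearrangement κ f) v := by
  set S : Set Ω := {x | rearrangement f (v ^ κ) < ‖f x‖ₑ}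
  have hS : MeasurableSet S := measurableSet_lt measurable_const f.measurable.enorm
  have hbounded : eLpNorm f ∞ (μ.restrict Sᶜ) ≤ rearrangement f (v ^ κ) :=
    eLpNormEssSup_le_of_ae_enorm_bound
      (ae_restrict_of_forall_mem hS.compl fun x hx => not_lt.1 hx)
  calc kFunctional (lebesgue μ 𝕜 (ENNReal.ofReal κ)) (lebesgue μ 𝕜 ∞) v f
      ≤ eLpNorm f (ENNReal.ofReal κ) (μ.restrict S) +
          ENNReal.ofReal v * eLpNorm f ∞ (μ.restrict Sᶜ) :=
        kFunctional_lebesgue_le_restrict _ _ hv f hS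
    _ ≤ 2 * dyadicHardy κ (scaledRearrangement κ f) v + scaledRearrangement κ f v :=
        add_le_add (eLpNorm_restrict_rearrangement_lt_le hκ f hv) (mul_le_mul_right hbounded _)
    _ ≤ 2 * dyadicHardy κ (scaledRearrangement κ f) v +
          dyadicHardy κ (scaledRearrangement κ f) v := by
        gcongr
        exact le_dyadicHardy hκ _ v
    _ = 3 * dyadicHardy κ (scaledRearrangement κ f) v := by ring

theorem scaledRearrangement_le_kFunctional {κ : ℝ} (hκ : 0 < κ) (f : Ω →ₘ[μ] 𝕜) {v : ℝ}
    (hv : 0 < v) :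
    scaledRearrangement κ f v ≤ kFunctional (weakLebesgue μ 𝕜 κ) (lebesgue μ 𝕜 ∞) v f := by
  refine le_kFunctional ?_
  rintro g - k - rfl
  have hg : scaledRearrangement κ g v ≤ (weakLebesgue μ 𝕜 κ).qnorm g := by
    have h := le_iSup₂ (f := fun (t : ℝ) (_ : 0 < t) =>
      ENNReal.ofReal (t ^ (1 / κ)) * rearrangement g t) (v ^ κ) (by positivity)
    rwa [← Real.rpow_mul hv.le, mul_one_div_cancel hκ.ne', Real.rpow_one] at h
  calc scaledRearrangement κ (g + k) v
      ≤ ENNReal.ofReal v * (rearrangement g (v ^ κ) + eLpNorm k ∞ μ) :=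
        mul_le_mul_right (rearrangement_add_le g k _) _
    _ = scaledRearrangement κ g v + ENNReal.ofReal v * eLpNorm k ∞ μ := mul_add _ _ _
    _ ≤ _ := add_le_add_left hg _

end KFunctional

section Embedding

variable {Ω 𝕜 : Type*} [MeasurableSpace Ω] [RCLike 𝕜] {μ : Measure Ω}
  {X Y X' Y' Z : FunctionSpace μ 𝕜}

theorem Embeds.refl (X : FunctionSpace μ 𝕜) : X.Embeds X :=
  ⟨subset_rfl, 1, one_pos, by simp⟩

theorem Embeds.trans (hXY : X.Embeds Y) (hYZ : Y.Embeds Z) : X.Embeds Z := by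
  obtain ⟨hXY, C, hC, hCle⟩ := hXY
  obtain ⟨hYZ, D, hD, hDle⟩ := hYZ
  refine ⟨hXY.trans hYZ, D * C, by positivity, fun f hf => ?_⟩
  rw [ENNReal.ofReal_mul hD.le, mul_assoc]
  exact (hDle f (hXY hf)).trans (mul_le_mul_right (hCle f hf) _)

theorem Embeds.of_qnorm_le {C : ℝ≥0∞} (hC : C ≠ ∞) (hX : ∀ f ∈ X.carrier, X.qnorm f < ∞)
    (hY : ∀ f, Y.qnorm f < ∞ → f ∈ Y.carrier) (h : ∀ f, Y.qnorm f ≤ C * X.qnorm f) :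
    X.Embeds Y := by
  refine ⟨fun f hf => hY f ((h f).trans_lt (ENNReal.mul_lt_top hC.lt_top (hX f hf))),
    C.toReal + 1, by positivity, fun f _ => (h f).trans ?_⟩
  gcongr
  exact (ENNReal.le_ofReal_iff_toReal_le hC (by positivity)).2 (le_add_of_nonneg_right zero_le_one)

theorem Embeds.exists_kFunctional_le (hX : X.Embeds X') (hY : Y.Embeds Y') :
    ∃ C : ℝ, 0 < C ∧ ∀ t f, kFunctional X' Y' t f ≤ ENNReal.ofReal C * kFunctional X Y t f := by
  obtain ⟨hXsub, C, hC, hCle⟩ := hX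
  obtain ⟨hYsub, D, -, hDle⟩ := hY
  have hpos : 0 < ENNReal.ofReal (max C D) := ENNReal.ofReal_pos.2 (lt_max_of_lt_left hC)
  refine ⟨max C D, lt_max_of_lt_left hC, fun t f => ?_⟩
  rw [← ENNReal.inv_mul_le_iff hpos.ne' ENNReal.ofReal_ne_top]
  refine le_kFunctional ?_
  rintro g hg k hk rfl
  rw [ENNReal.inv_mul_le_iff hpos.ne' ENNReal.ofReal_ne_top]
  calc kFunctional X' Y' t (g + k)
      ≤ X'.qnorm g + ENNReal.ofReal t * Y'.qnorm k := kFunctional_add_le (hXsub hg) (hYsub hk) t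
    _ ≤ ENNReal.ofReal (max C D) * X.qnorm g +
          ENNReal.ofReal t * (ENNReal.ofReal (max C D) * Y.qnorm k) := by
        gcongr
        · exact (hCle g hg).trans (by gcongr; exact le_max_left C D)
        · exact (hDle k hk).trans (by gcongr; exact le_max_right C D)
    _ = ENNReal.ofReal (max C D) * (X.qnorm g + ENNReal.ofReal t * Y.qnorm k) := by ring

variable {θ κ : ℝ} {p q r s : ℝ≥0∞} {a b c : ℝ → ℝ}

theorem Embeds.interpolationLR (hX : X.Embeds X') (hY : Y.Embeds Y') :
    (interpolationLR X Y θ s c r b q a).Embeds (interpolationLR X' Y' θ s c r b q a) := by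
  obtain ⟨C, hC, hK⟩ := hX.exists_kFunctional_le hY
  have hle (f : Ω →ₘ[μ] 𝕜) := iteratedNormLR_le_mul (α := -θ) (s := s) (c := c) (r := r) (b := b)
    (q := q) (a := a) (g := fun v => kFunctional X' Y' v f) ENNReal.ofReal_ne_top
    fun v _ => hK v f
  refine ⟨fun f ⟨⟨g, hg, k, hk, hgk⟩, hfin⟩ => ⟨⟨g, hX.1 hg, k, hY.1 hk, hgk⟩, ?_⟩, C, hC,
    fun f _ => hle f⟩
  exact (hle f).trans_lt (ENNReal.mul_lt_top ENNReal.ofReal_lt_top hfin)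

theorem mem_interpolationLR_of_qnorm_lt_top (hs : 0 < s) (hr : 0 < r) (hq : 0 < q)
    (ha : ∀ t, 0 < t → 0 < a t) (hb : ∀ t, 0 < t → 0 < b t) (hc : ∀ t, 0 < t → 0 < c t)
    {f : Ω →ₘ[μ] 𝕜} (hf : (interpolationLR X Y θ s c r b q a).qnorm f < ∞) :
    f ∈ (interpolationLR X Y θ s c r b q a).carrier := by
  refine ⟨?_, hf⟩
  by_contra hsum
  refine hf.ne (iteratedNormLR_eq_top hs hr hq ha hb hc fun v _ => ?_)
  by_contra hv
  exact hsum (mem_sumSet_of_kFunctional_ne_top hv)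

theorem lebesgue_embeds_weakLebesgue (hκ : 0 < κ) :
    (lebesgue μ 𝕜 (ENNReal.ofReal κ)).Embeds (weakLebesgue μ 𝕜 κ) :=
  .of_qnorm_le ENNReal.one_ne_top (fun _ hf => hf) (fun _ hf => hf) fun f => by
    rw [one_mul]
    exact iSup₂_le fun _ ht => rpow_mul_rearrangement_le hκ f ht

theorem toReal_one_div_ofReal_div_ofReal (hθ1 : θ ≤ 1) (hκ : 0 < κ) :
    (1 / (ENNReal.ofReal κ / ENNReal.ofReal (1 - θ))).toReal = 1 / κ * (1 - θ) := by
  rw [one_div, ENNReal.inv_div (Or.inl ENNReal.ofReal_ne_top) (Or.inr (by simpa using hκ)),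
    ENNReal.toReal_div, ENNReal.toReal_ofReal hκ.le, ENNReal.toReal_ofReal (by linarith)]
  ring

theorem exists_iteratedNormLR_scaledRearrangement_eq (hθ1 : θ ≤ 1) (hκ : 0 < κ)
    (hp : p = ENNReal.ofReal κ / ENNReal.ofReal (1 - θ)) (hs : 0 < s) (hr : 0 < r) (hq : 0 < q) :
    ∃ C : ℝ≥0∞, C ≠ 0 ∧ C ≠ ∞ ∧ ∀ f : Ω →ₘ[μ] 𝕜,
      iteratedNormLR (-θ) s c r b q a (scaledRearrangement κ f) =
        C * (lorentzKaramataLR μ 𝕜 p s (rescale κ c) r (rescale κ b) q (rescale κ a)).qnorm f := by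
  have hm : 0 < 1 / κ := by positivity
  refine ⟨ENNReal.ofReal ((1 / κ) ^ (1 / s).toReal) * (ENNReal.ofReal ((1 / κ) ^ (1 / r).toReal) *
    ENNReal.ofReal (1 ^ (1 - θ) * (1 / κ) ^ (1 / q).toReal)), ?_, by finiteness, fun f => ?_⟩
  · simp only [ne_eq, mul_eq_zero, ENNReal.ofReal_eq_zero, not_or, not_le]
    exact ⟨by positivity, by positivity, by positivity⟩
  calc iteratedNormLR (-θ) s c r b q a (scaledRearrangement κ f)
      = iteratedNormLR (1 - θ) s c r b q a (fun v => rearrangement f (v ^ κ)) := by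
        refine normOn_congr measurableSet_Ioi fun t ht => congrArg _ ?_
        refine normOn_congr measurableSet_Ioi fun u _ => congrArg _ ?_
        refine normOn_congr measurableSet_Ioo fun v hv => ?_
        rw [scaledRearrangement, ← mul_assoc, weight_mul_ofReal (ht.out.trans hv.1),
          ← sub_eq_add_neg]
    _ = _ := by
        rw [iteratedNormLR_comp_mul_rpow one_pos hm hs hr hq, lorentzKaramataLR, hp]
        simp only [ofQNorm, toReal_one_div_ofReal_div_ofReal hθ1 hκ, one_mul]
        refine congrArg _ (iteratedNormLR_congr fun v hv => ?_)
        rw [one_div, Real.rpow_inv_rpow hv.le hκ.ne']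

theorem interpolationLR_weakLebesgue_embeds_lorentzKaramataLR (hθ1 : θ ≤ 1) (hκ : 0 < κ)
    (hp : p = ENNReal.ofReal κ / ENNReal.ofReal (1 - θ)) (hs : 0 < s) (hr : 0 < r) (hq : 0 < q) :
    (interpolationLR (weakLebesgue μ 𝕜 κ) (lebesgue μ 𝕜 ∞) θ s c r b q a).Embeds
      (lorentzKaramataLR μ 𝕜 p s (rescale κ c) r (rescale κ b) q (rescale κ a)) := by
  obtain ⟨C, hC0, hC, hCeq⟩ := exists_iteratedNormLR_scaledRearrangement_eq (μ := μ) (𝕜 := 𝕜)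
    (a := a) (b := b) (c := c) hθ1 hκ hp hs hr hq
  refine .of_qnorm_le (ENNReal.inv_ne_top.2 hC0) (fun _ hf => hf.2) (fun _ hf => hf) fun f => ?_
  rw [← ENNReal.div_eq_inv_mul, ENNReal.le_div_iff_mul_le (Or.inl hC0) (Or.inl hC), mul_comm,
    ← hCeq]
  exact iteratedNormLR_mono fun v hv => scaledRearrangement_le_kFunctional hκ f hv

theorem lorentzKaramataLR_embeds_interpolationLR_lebesgue {εa εb εc : ℝ}
    (hθ : εa + εb + εc < θ) (hθ1 : θ ≤ 1) (hκ : 0 < κ)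
    (hp : p = ENNReal.ofReal κ / ENNReal.ofReal (1 - θ)) (hs : 0 < s) (hr : 0 < r) (hq : 0 < q)
    (ha : IsUpperTypeWeight εa a) (hb : IsUpperTypeWeight εb b) (hc : IsUpperTypeWeight εc c) :
    (lorentzKaramataLR μ 𝕜 p s (rescale κ c) r (rescale κ b) q (rescale κ a)).Embeds
      (interpolationLR (lebesgue μ 𝕜 (ENNReal.ofReal κ)) (lebesgue μ 𝕜 ∞)
        θ s c r b q a) := by
  obtain ⟨C, -, hC, hCeq⟩ := exists_iteratedNormLR_scaledRearrangement_eq (μ := μ) (𝕜 := 𝕜)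
    (a := a) (b := b) (c := c) hθ1 hκ hp hs hr hq
  obtain ⟨D, hD, hardy⟩ := exists_iteratedNormLR_dyadicHardy_le (α := -θ) hκ (by linarith)
    ha hb hc hs hr hq
  refine .of_qnorm_le (C := 3 * (D * C)) (by finiteness) (fun _ hf => hf)
    (fun _ => mem_interpolationLR_of_qnorm_lt_top hs hr hq ha.pos hb.pos hc.pos) fun f => ?_
  calc iteratedNormLR (-θ) s c r b q a
        (fun v => kFunctional (lebesgue μ 𝕜 (ENNReal.ofReal κ)) (lebesgue μ 𝕜 ∞) v f)
      ≤ 3 * iteratedNormLR (-θ) s c r b q a (dyadicHardy κ (scaledRearrangement κ f)) :=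
        iteratedNormLR_le_mul (by finiteness) fun v hv =>
          kFunctional_lebesgue_le_dyadicHardy hκ f hv
    _ ≤ 3 * (D * iteratedNormLR (-θ) s c r b q a (scaledRearrangement κ f)) := by
        gcongr
        exact hardy _ (measurable_scaledRearrangement κ f)
    _ = 3 * (D * C) * _ := by rw [hCeq]; ring

end Embedding

end FunctionSpace

theorem theorem5p6_general {Ω : Type*} [MeasurableSpace Ω] (μ : Measure Ω)
    (𝕜 : Type*) [RCLike 𝕜] (θ κ : ℝ) (hθ1 : θ ≤ 1) (hκ : 0 < κ)
    (p q r s : ℝ≥0∞) (hp : p = ENNReal.ofReal κ / ENNReal.ofReal (1 - θ))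
    (hq : 0 < q) (hr : 0 < r) (hs : 0 < s) (a b c : ℝ → ℝ) (εa εb εc : ℝ)
    (ha : IsUpperTypeWeight εa a) (hb : IsUpperTypeWeight εb b) (hc : IsUpperTypeWeight εc c)
    (hθ : εa + εb + εc < θ) :
    FunctionSpace.Same
      (FunctionSpace.interpolationLR (FunctionSpace.lebesgue μ 𝕜 (ENNReal.ofReal κ))
        (FunctionSpace.lebesgue μ 𝕜 ∞) θ s c r b q a)
      (FunctionSpace.interpolationLR (FunctionSpace.weakLebesgue μ 𝕜 κ)
        (FunctionSpace.lebesgue μ 𝕜 ∞) θ s c r b q a) ∧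
    FunctionSpace.Same
      (FunctionSpace.interpolationLR (FunctionSpace.weakLebesgue μ 𝕜 κ)
        (FunctionSpace.lebesgue μ 𝕜 ∞) θ s c r b q a)
      (FunctionSpace.lorentzKaramataLR μ 𝕜 p s (rescale κ c) r (rescale κ b) q
        (rescale κ a)) := by
  have hstrong_weak := (FunctionSpace.lebesgue_embeds_weakLebesgue (μ := μ) (𝕜 := 𝕜)
    hκ).interpolationLR (.refl (FunctionSpace.lebesgue μ 𝕜 ∞))
    (θ := θ) (s := s) (r := r) (q := q) (a := a) (b := b) (c := c)
  have hweak_lorentz := FunctionSpace.interpolationLR_weakLebesgue_embeds_lorentzKaramataLR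
    (μ := μ) (𝕜 := 𝕜) (a := a) (b := b) (c := c) hθ1 hκ hp hs hr hq
  have hlorentz_strong := FunctionSpace.lorentzKaramataLR_embeds_interpolationLR_lebesgue
    (μ := μ) (𝕜 := 𝕜) hθ hθ1 hκ hp hs hr hq ha hb hc
  exact ⟨⟨hstrong_weak, hweak_lorentz.trans hlorentz_strong⟩,
    ⟨hweak_lorentz, hlorentz_strong.trans hstrong_weak⟩⟩

theorem theorem5p6 {Ω : Type*} [MeasurableSpace Ω] (μ : Measure Ω) [SigmaFinite μ]
    (hμ : IsNonatomicMeasure μ) (𝕜 : Type*) [RCLike 𝕜]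
    (θ κ : ℝ) (hθ0 : 0 < θ) (hθ1 : θ ≤ 1) (hκ : 0 < κ)
    (p q r s : ℝ≥0∞) (hp : p = ENNReal.ofReal κ / ENNReal.ofReal (1 - θ))
    (hq : 0 < q) (hr : 0 < r) (hs : 0 < s)
    (a b c : ℝ → ℝ)
    (ha : IsSlowlyVarying a) (hb : IsSlowlyVarying b) (hc : IsSlowlyVarying c)
    (hb1 : normOn r (Ioi 1) (weight 0 r b) < ∞) :
    FunctionSpace.Same
      (FunctionSpace.interpolationLR (FunctionSpace.lebesgue μ 𝕜 (ENNReal.ofReal κ))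
        (FunctionSpace.lebesgue μ 𝕜 ∞) θ s c r b q a)
      (FunctionSpace.interpolationLR (FunctionSpace.weakLebesgue μ 𝕜 κ)
        (FunctionSpace.lebesgue μ 𝕜 ∞) θ s c r b q a) ∧
    FunctionSpace.Same
      (FunctionSpace.interpolationLR (FunctionSpace.weakLebesgue μ 𝕜 κ)
        (FunctionSpace.lebesgue μ 𝕜 ∞) θ s c r b q a)
      (FunctionSpace.lorentzKaramataLR μ 𝕜 p s (rescale κ c) r (rescale κ b) q
        (rescale κ a)) := by
  have hε : 0 < θ / 4 := by positivity
  exact theorem5p6_general μ 𝕜 θ κ hθ1 hκ p q r s hp hq hr hs a b c _ _ _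
    (ha.isUpperTypeWeight hε) (hb.isUpperTypeWeight hε) (hc.isUpperTypeWeight hε) (by linarith)
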